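/- Let $L/K$ be a finite separable extension of fields, and let $\widetilde L$ be a normal closure of $L/K$. A *Hopf Galois structure* on $L/K$ is a pair $(\mathcal H,\mu)$, where $\mathcal H$ is a finite-dimensional cocommutative $K$-Hopf algebra and $\mu\colon \mathcal H\to \operatorname{End}_K(L)$ is a $K$-linear map that makes $L$ a left $\mathcal H$-module algebra and for which the $K$-linear map $L\otimes_K\mathcal H\to \operatorname{End}_K(L)$, $l\otimes h\mapsto \bigl(x\mapsto l\,\mu(h)(x)\bigr)$, is bijective. Such a structure has *type* $N$, for a group $N$, if $\widetilde L\otimes_K\mathcal H\cong \widetilde L[N]$ as $\widetilde L$-Hopf algebras (equivalently, if $N$ is isomorphic to the regular permutation group that corresponds to $(\mathcal H,\mu)$ under the Greither–Pareigis correspondence). **Theorem.** Let $p>3$ be a prime and let $L/K$ be a separable field extension of degree $p^3$. If $L/K$ has a Hopf Galois structure of type $C_{p^2}\times C_p$, then it has no Hopf Galois structure of type $C_p\times C_p\times C_p$. -/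

import Mathlib

open scoped TensorProduct

universe w₁ w₂

/-- The canonical `K`-linear map `L ⊗[K] H → End_K(L)`, `l ⊗ h ↦ (x ↦ l * μ h x)`, attached to
an action `μ : H → End_K(L)`. -/
noncomputable def hopfGaloisMap {K L H : Type*} [Field K] [Field L] [Algebra K L] [Ring H]
    [Algebra K H] (μ : H →ₐ[K] Module.End K L) : L ⊗[K] H →ₗ[K] Module.End K L :=
  TensorProduct.lift
    ((LinearMap.mul K (Module.End K L)).compl₁₂ (Algebra.lmul K L).toLinearMap μ.toLinearMap)

theorem hopfGaloisMap_tmul_apply {K L H : Type*} [Field K] [Field L] [Algebra K L] [Ring H]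
    [Algebra K H] (μ : H →ₐ[K] Module.End K L) (l : L) (h : H) (x : L) :
    hopfGaloisMap μ (l ⊗ₜ[K] h) x = l * μ h x := by
  simp [hopfGaloisMap]

/-- A Hopf Galois structure on the field extension `L/K`: a finite cocommutative `K`-Hopf algebra
`H` and a Hopf action `μ : H → End_K(L)`, i.e. `μ` makes `L` a left `H`-module algebra and induces
a bijection `L ⊗[K] H → End_K(L)`. -/
structure HopfGaloisStructure.{w, u, v} (K : Type u) (L : Type v) [Field K] [Field L]
    [Algebra K L] where
  /-- The underlying Hopf algebra. -/
  H : Type w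
  [ring : Ring H]
  [hopfAlgebra : HopfAlgebra K H]
  [finite : Module.Finite K H]
  [cocomm : Coalgebra.IsCocomm K H]
  /-- The action; being an algebra homomorphism, it makes `L` a left `H`-module. -/
  μ : H →ₐ[K] Module.End K L
  /-- `h · 1 = ε(h) 1`. -/
  act_one : ∀ h : H, μ h 1 = algebraMap K L (Coalgebra.counit (R := K) h)
  /-- `h · (x y) = ∑ (h₁ · x) (h₂ · y)`, where `Δ(h) = ∑ h₁ ⊗ h₂`. -/
  act_mul : ∀ (h : H) (x y : L), μ h (x * y) =
    LinearMap.mul' K L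
      (TensorProduct.map (μ.toLinearMap.flip x) (μ.toLinearMap.flip y)
        (Coalgebra.comul (R := K) h))
  /-- The Galois condition. -/
  bijective : Function.Bijective (hopfGaloisMap μ)

attribute [instance] HopfGaloisStructure.ring HopfGaloisStructure.hopfAlgebra
  HopfGaloisStructure.finite HopfGaloisStructure.cocomm

/-- The Hopf Galois structure `S` on `L/K` has type `N` (an abstract group), with respect to a
normal closure `E` of `L/K`: the base change `E ⊗[K] H` is isomorphic, as an `E`-Hopf algebra, to
the group algebra `E[N]`. (A bialgebra isomorphism between Hopf algebras automatically respects
antipodes.) -/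
def HopfGaloisStructure.HasType {K L : Type*} [Field K] [Field L] [Algebra K L]
    (S : HopfGaloisStructure K L) (E : Type*) [Field E] [Algebra K E] [IsNormalClosure K L E]
    (N : Type*) [Group N] : Prop :=
  Nonempty ((E ⊗[K] S.H) ≃ₐc[E] MonoidAlgebra E N)

/-! By Greither–Pareigis, each structure gives a regular action of its type `N` on the `p ^ 3`
embeddings of `L` into `E`, normalised by the Galois group (`exists_regular_action`). A Sylow
`p`-subgroup is still transitive, so it contains `σ` with `σ x₀ = v₁ x₀`, where `v₁` has order `p ^
2` in `C_{p²} × C_p`. If `α` is conjugation by `σ` on `N` and `σ x₀ = v x₀`, then `σ ^ p` moves `x₀`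
by `(1 + α + ⋯ + α ^ (p - 1)) v`. With `δ = α - 1` one has `δ ^ 3 = 0` and `p δ = 0`, so for `p > 3`
this sum is just `p` (`perm_pow_prime_apply`). Hence the first action gives `σ ^ p x₀ = v₁ ^ p x₀ ≠
x₀`, while the elementary abelian one gives `σ ^ p x₀ = x₀`. -/

namespace HopfGalois

/-! ### Base-changed Hopf action on linear maps `L → E` -/

section Orbit

variable {K L E H : Type*} [Field K] [Field L] [Algebra K L] [Field E] [Algebra K E]
  [Ring H] [HopfAlgebra K H]

/-- The map `E ⊗[K] H → Hom_K(L, E)`, `e ⊗ h ↦ (l ↦ e * f (μ h l))`. -/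
noncomputable def orbitMap (μ : H →ₐ[K] Module.End K L) (f : L →ₗ[K] E) :
    E ⊗[K] H →ₗ[E] (L →ₗ[K] E) :=
  LinearMap.liftBaseChange E ((LinearMap.compRight K f) ∘ₗ μ.toLinearMap)

variable (μ : H →ₐ[K] Module.End K L)

@[simp]
theorem orbitMap_tmul (f : L →ₗ[K] E) (e : E) (h : H) (l : L) :
    orbitMap μ f (e ⊗ₜ h) l = e * f (μ h l) := by
  simp [orbitMap]

theorem orbitMap_one (f : L →ₗ[K] E) : orbitMap μ f 1 = f := by
  ext l
  simp [Algebra.TensorProduct.one_def]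

/-- Precomposition reverses order, so this is a right action. -/
theorem orbitMap_orbitMap (f : L →ₗ[K] E) (t s : E ⊗[K] H) :
    orbitMap μ (orbitMap μ f t) s = orbitMap μ f (t * s) := by
  induction s using TensorProduct.induction_on with
  | zero => simp
  | add a b ha hb => simp [mul_add, ha, hb]
  | tmul e h =>
    ext l
    rw [orbitMap_tmul]
    induction t using TensorProduct.induction_on with
    | zero => simp
    | add a b ha hb => simp [mul_add, add_mul, ha, hb]
    | tmul e' h' => simp; ring

theorem comp_orbitMap (g : E →ₐ[K] E) (f : L →ₗ[K] E) (t : E ⊗[K] H) :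
    g.toLinearMap ∘ₗ orbitMap μ f t =
      orbitMap μ (g.toLinearMap ∘ₗ f) (Algebra.TensorProduct.map g (AlgHom.id K H) t) := by
  induction t using TensorProduct.induction_on with
  | zero => simp
  | add a b ha hb => simp [LinearMap.comp_add, ha, hb]
  | tmul e h => ext l; simp

/-- The Galois condition puts every `x ∘ φ` in the range; rank-one `φ` built from a basis of `L`
already span `Hom_K(L, E)` over `E`. -/
theorem orbitMap_surjective [FiniteDimensional K L] (hμ : Function.Surjective (hopfGaloisMap μ))
    (x : L →ₐ[K] E) : Function.Surjective (orbitMap μ x.toLinearMap) := by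
  have key : ∀ φ : Module.End K L, x.toLinearMap ∘ₗ φ ∈ (orbitMap μ x.toLinearMap).range := by
    intro φ
    obtain ⟨t, rfl⟩ := hμ φ
    induction t using TensorProduct.induction_on with
    | zero => simp
    | add a b ha hb => simpa [LinearMap.comp_add] using add_mem ha hb
    | tmul l h =>
      refine ⟨x l ⊗ₜ h, ?_⟩
      ext y
      simp [hopfGaloisMap_tmul_apply]
  rw [← LinearMap.range_eq_top, eq_top_iff]
  intro f _
  let b := Module.finBasis K L
  have : f = ∑ i, f (b i) • (x.toLinearMap ∘ₗ (b.coord i).smulRight (1 : L)) := by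
    refine b.ext fun j => ?_
    simp [LinearMap.sum_apply, Finsupp.single_apply, apply_ite]
  rw [this]
  exact sum_mem fun i _ => Submodule.smul_mem _ _ (key _)

/-- With `orbitMap_apply_mul`, this makes group-like elements send embeddings to embeddings. -/
theorem orbitMap_apply_one (act_one : ∀ h : H, μ h 1 = algebraMap K L (Coalgebra.counit (R := K) h))
    (x : L →ₐ[K] E) (t : E ⊗[K] H) :
    orbitMap μ x.toLinearMap t 1 = Coalgebra.counit (R := E) t := by
  induction t using TensorProduct.induction_on with
  | zero => simp
  | add a b ha hb => simp [ha, hb]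
  | tmul e h => simp [act_one, Algebra.smul_def, mul_comm]

theorem orbitMap_apply_mul (act_mul : ∀ (h : H) (x y : L), μ h (x * y) =
    LinearMap.mul' K L
      (TensorProduct.map (μ.toLinearMap.flip x) (μ.toLinearMap.flip y)
        (Coalgebra.comul (R := K) h)))
    (x : L →ₐ[K] E) (t : E ⊗[K] H) (l m : L) :
    orbitMap μ x.toLinearMap t (l * m) =
      LinearMap.mul' E E (TensorProduct.map ((orbitMap μ x.toLinearMap).flip l)
        ((orbitMap μ x.toLinearMap).flip m) (Coalgebra.comul (R := E) t)) := by
  induction t using TensorProduct.induction_on with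
  | zero => simp
  | add a b ha hb => simp [ha, hb]
  | tmul e h =>
    rw [TensorProduct.comul_tmul, orbitMap_tmul, act_mul]
    generalize Coalgebra.comul (R := K) h = c
    induction c using TensorProduct.induction_on with
    | zero => simp
    | add a b ha hb => simp only [map_add, TensorProduct.tmul_add, mul_add, ha, hb]
    | tmul h₁ h₂ => simp; ring

end Orbit

/-! ### Unipotent endomorphisms of abelian `p`-groups -/

/-- A nilpotent endomorphism of a finite abelian group of order `p ^ n` has index at most `n`. -/
theorem pow_eq_zero_of_isNilpotent_of_card {p : ℕ} (hp : p.Prime) (n : ℕ) {M : Type*}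
    [AddCommGroup M] (δ : AddMonoid.End M) (hδ : IsNilpotent δ) (hM : Nat.card M = p ^ n) :
    δ ^ n = 0 := by
  have hfin : Finite M := Nat.finite_of_card_ne_zero (by rw [hM]; exact pow_ne_zero _ hp.ne_zero)
  have key : ∀ i, i ≤ n → ∃ j ≤ n - i, Nat.card (AddMonoidHom.range (δ ^ i : M →+ M)) = p ^ j := by
    intro i
    induction i with
    | zero =>
      intro _
      refine ⟨n, le_rfl, ?_⟩
      rw [← hM, pow_zero]
      exact Nat.card_congr (Equiv.subtypeUnivEquiv fun x => ⟨x, rfl⟩)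
    | succ i ih =>
      intro hi
      obtain ⟨j, hj, hc⟩ := ih (by omega)
      have hle : AddMonoidHom.range (δ ^ (i + 1) : M →+ M) ≤ AddMonoidHom.range (δ ^ i : M →+ M) := by
        rintro _ ⟨y, rfl⟩
        exact ⟨δ y, by rw [pow_succ]; rfl⟩
      have hdvd := AddSubgroup.card_dvd_of_le hle
      rw [hc] at hdvd
      obtain ⟨k, hk, hck⟩ := (Nat.dvd_prime_pow hp).1 hdvd
      -- Either the image of `δ ^ i` shrinks by a factor of at least `p`, or it is stable from here
      -- on and nilpotence makes it zero.
      by_cases hkj : k = j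
      · subst hkj
        have heq := AddSubgroup.eq_of_le_of_card_ge hle (by rw [hc, hck])
        have hall : ∀ r, AddMonoidHom.range (δ ^ (i + r) : M →+ M) =
            AddMonoidHom.range (δ ^ i : M →+ M) := by
          intro r
          induction r with
          | zero => rfl
          | succ r ihr =>
            rw [← heq]
            ext z
            constructor
            · rintro ⟨y, rfl⟩
              have : (δ ^ (i + r)) y ∈ AddMonoidHom.range (δ ^ i : M →+ M) := ihr ▸ ⟨y, rfl⟩
              obtain ⟨w, hw⟩ := this
              refine ⟨w, ?_⟩
              rw [← add_assoc, pow_succ', pow_succ']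
              exact congrArg δ hw
            · rintro ⟨y, rfl⟩
              have : (δ ^ i) y ∈ AddMonoidHom.range (δ ^ (i + r) : M →+ M) := ihr ▸ ⟨y, rfl⟩
              obtain ⟨w, hw⟩ := this
              refine ⟨w, ?_⟩
              rw [← add_assoc, pow_succ', pow_succ']
              exact congrArg δ hw
        obtain ⟨s, hs⟩ := hδ
        have h0 := hall s
        have hbot : AddMonoidHom.range (δ ^ (i + s) : M →+ M) = ⊥ := by
          rw [pow_add, hs, mul_zero]
          rw [eq_bot_iff]
          rintro _ ⟨y, rfl⟩
          exact AddSubgroup.mem_bot.2 rfl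
        refine ⟨0, Nat.zero_le _, ?_⟩
        rw [heq, ← h0, hbot]
        simp
      · refine ⟨k, ?_, hck⟩
        omega
  obtain ⟨j, hj, hc⟩ := key n le_rfl
  obtain rfl : j = 0 := by omega
  rw [pow_zero] at hc
  have hb := AddSubgroup.eq_bot_of_card_eq _ hc
  ext x
  have : (δ ^ n) x ∈ AddMonoidHom.range (δ ^ n : M →+ M) := ⟨x, rfl⟩
  rw [hb] at this
  exact AddSubgroup.mem_bot.1 this

/-- In a ring in which `p` is nilpotent, an element of `p`-power order is unipotent. -/
theorem isNilpotent_sub_one_of_pow_eq_one {R : Type*} [Ring R] {p k : ℕ} (hp : p.Prime) (a : R)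
    (ha : a ^ p ^ k = 1) (hpR : IsNilpotent (p : R)) : IsNilpotent (a - 1) := by
  obtain ⟨r, hr⟩ := (Commute.one_right (a - 1)).exists_add_pow_prime_pow_eq hp k
  rw [sub_add_cancel, ha, one_pow, mul_one, mul_assoc] at hr
  have h1 : (a - 1) ^ p ^ k = -((p : R) * ((a - 1) * r)) := by
    rw [eq_neg_iff_add_eq_zero]
    have := sub_eq_zero.2 hr.symm
    rw [← this]
    abel
  have h2 : IsNilpotent ((a - 1) ^ p ^ k) := by
    rw [h1]
    exact ((Nat.cast_commute p ((a - 1) * r)).isNilpotent_mul_right hpR).neg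
  exact h2.of_pow

theorem pow_eq_and_geom_sum_eq_of_cube_zero {R : Type*} [Ring R] (a : R) (h3 : (a - 1) ^ 3 = 0)
    (n : ℕ) : a ^ n = 1 + n • (a - 1) + n.choose 2 • (a - 1) ^ 2 ∧
      ∑ i ∈ Finset.range n, a ^ i = n • 1 + n.choose 2 • (a - 1) + n.choose 3 • (a - 1) ^ 2 := by
  induction n with
  | zero => simp
  | succ n ih =>
    obtain ⟨h1, h2⟩ := ih
    obtain ⟨δ, rfl⟩ : ∃ δ, a = δ + 1 := ⟨a - 1, by simp⟩
    rw [add_sub_cancel_right] at *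
    constructor
    · have e3 : δ ^ 2 * δ = 0 := by rw [← pow_succ, h3]
      rw [pow_succ, h1, Nat.choose_succ_succ' n 1, Nat.choose_one_right]
      simp only [mul_add, add_mul, smul_mul_assoc, e3, one_mul, mul_one, ← pow_two, smul_zero]
      module
    · rw [Finset.sum_range_succ, h2, h1, Nat.choose_succ_succ' n 1, Nat.choose_succ_succ' n 2,
        Nat.choose_one_right]
      module

/-- For `p > 3`, `p` divides both `p.choose 2` and `p.choose 3`, so the terms in `a - 1` and `(a -
1) ^ 2` vanish. -/
theorem geom_sum_eq_of_cube_zero {R : Type*} [Ring R] {p : ℕ} (hp : p.Prime) (hp3 : 3 < p)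
    (a : R) (h3 : (a - 1) ^ 3 = 0) (hpa : (p : R) * (a - 1) = 0) :
    ∑ i ∈ Finset.range p, a ^ i = (p : R) := by
  obtain ⟨c, hc⟩ := hp.dvd_choose_self two_ne_zero (by omega)
  obtain ⟨d, hd⟩ := hp.dvd_choose_self three_ne_zero hp3
  have e : p • (a - 1) = 0 := by rw [nsmul_eq_mul, hpa]
  have e2 : p • (a - 1) ^ 2 = 0 := by rw [pow_two, ← smul_mul_assoc, e, zero_mul]
  rw [(pow_eq_and_geom_sum_eq_of_cube_zero a h3 p).2, hc, hd, mul_comm p, mul_comm p, mul_smul,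
    mul_smul, e, e2]
  simp

/-- If `p M` is cyclic of order dividing `p`, nilpotent endomorphisms of `M` annihilate it. -/
theorem natCast_mul_eq_zero_of_isNilpotent {M : Type*} [AddCommGroup M] {p : ℕ} (hp : p.Prime)
    (u : M) (hu : p • p • u = 0) (hgen : ∀ m : M, ∃ c : ℕ, p • m = c • p • u)
    (δ : AddMonoid.End M) (hδ : IsNilpotent δ) : (p : AddMonoid.End M) * δ = 0 := by
  -- `p • u` is an eigenvector of `δ` with eigenvalue `c`; nilpotence forces `p ∣ c` or `p • u = 0`.
  have hw : δ (p • u) = 0 := by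
    obtain ⟨c, hc⟩ := hgen (δ u)
    rw [← map_nsmul] at hc
    have hpow : ∀ k : ℕ, (δ ^ k) (p • u) = c ^ k • p • u := by
      intro k
      induction k with
      | zero => simp
      | succ k ih =>
        rw [pow_succ', AddMonoid.End.coe_mul, Function.comp_apply, ih, map_nsmul, hc, pow_succ, mul_smul]
    obtain ⟨k, hk⟩ := hδ
    have h0 := hpow k
    rw [hk, AddMonoid.End.zero_apply] at h0
    by_cases hpc : p ∣ c
    · obtain ⟨d, rfl⟩ := hpc
      rw [hc, mul_comm, mul_smul, hu, smul_zero]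
    · have h1 : addOrderOf (p • u) = 1 := Nat.eq_one_of_dvd_coprimes
        (((hp.coprime_iff_not_dvd.2 hpc).pow_right k)) (addOrderOf_dvd_of_nsmul_eq_zero hu)
        (addOrderOf_dvd_of_nsmul_eq_zero h0.symm)
      rw [AddMonoid.addOrderOf_eq_one_iff.1 h1, map_zero]
  ext m
  obtain ⟨c, hc⟩ := hgen m
  rw [AddMonoid.End.coe_mul, Function.comp_apply, AddMonoid.End.natCast_apply, ← map_nsmul, hc, map_nsmul, hw]
  simp

/-- `p ^ n` divides the index of `Stab ∩ P`, which is the `P`-orbit length times the index of `P`,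
and the latter is prime to `p`. -/
theorem isPretransitive_sylow {G X : Type*} [Group G] [Finite G] [MulAction G X]
    [MulAction.IsPretransitive G X] {p n : ℕ} [Fact p.Prime] (hX : Nat.card X = p ^ n)
    (P : Sylow p G) : MulAction.IsPretransitive P X := by
  have hp : p.Prime := Fact.out
  have : Finite X := Nat.finite_of_card_ne_zero (by rw [hX]; exact pow_ne_zero _ hp.ne_zero)
  have : Nonempty X := (Nat.card_pos_iff.1 (hX ▸ pow_pos hp.pos n)).1
  obtain ⟨x⟩ := this
  rw [MulAction.isPretransitive_iff_orbit_eq_univ x]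
  have h1 := Subgroup.index_dvd_of_le (inf_le_left : MulAction.stabilizer G x ⊓ P ≤ _)
  rw [← Subgroup.relIndex_mul_index (inf_le_right : MulAction.stabilizer G x ⊓ P ≤ _),
    MulAction.index_stabilizer_of_transitive, hX, Subgroup.inf_relIndex_right] at h1
  have h2 : (MulAction.stabilizer G x).relIndex P = (MulAction.orbit P x).ncard := by
    rw [← MulAction.index_stabilizer]
    rfl
  rw [h2] at h1
  have h3 := (((Nat.Prime.coprime_iff_not_dvd hp).2 P.not_dvd_index).pow_left n).dvd_of_dvd_mul_right
    h1
  rw [Set.eq_univ_iff_ncard, hX]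
  refine le_antisymm (hX ▸ Set.ncard_le_card _) (Nat.le_of_dvd ?_ h3)
  exact (Set.ncard_pos).2 (MulAction.nonempty_orbit x)

/-! ### Permutations normalising a regular abelian group -/

section Affine

variable {N X : Type*} [CommGroup N] (act : N →* Equiv.Perm X)

theorem perm_pow_act (σ : Equiv.Perm X) (a : AddMonoid.End (Additive N))
    (ha : ∀ n x, σ (act n x) = act (a (.ofMul n)).toMul (σ x)) (k : ℕ) (n : N) (x : X) :
    (σ ^ k) (act n x) = act ((a ^ k) (.ofMul n)).toMul ((σ ^ k) x) := by
  induction k with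
  | zero => simp
  | succ k ih => simp only [pow_succ', Equiv.Perm.mul_apply, ih, ha, AddMonoid.End.coe_mul, Function.comp_apply, ofMul_toMul]

theorem perm_pow_apply (σ : Equiv.Perm X) (a : AddMonoid.End (Additive N))
    (ha : ∀ n x, σ (act n x) = act (a (.ofMul n)).toMul (σ x)) (v : N) (x : X)
    (hv : σ x = act v x) (k : ℕ) :
    (σ ^ k) x = act ((∑ i ∈ Finset.range k, a ^ i) (.ofMul v)).toMul x := by
  induction k with
  | zero => simp
  | succ k ih =>
    rw [pow_succ', Equiv.Perm.mul_apply, ih, ha, geom_sum_succ, hv, ← Equiv.Perm.mul_apply,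
      ← map_mul]
    rfl

/-- A permutation of `p`-power order which normalises a regular abelian permutation group `N` of
order `p ^ 3` with `N ^ p` cyclic of order at most `p`, and which moves `x` to `v x`, has
`p`-th power moving `x` to `v ^ p x`. -/
theorem perm_pow_prime_apply {p k : ℕ} (hp : p.Prime) (hp3 : 3 < p) (hN : Nat.card N = p ^ 3)
    (hu : ∃ u : N, (u ^ p) ^ p = 1 ∧ ∀ m : N, ∃ c : ℕ, m ^ p = (u ^ p) ^ c)
    (hinj : ∀ x, Function.Injective fun n => act n x)
    (σ : Equiv.Perm X) (hσ : σ ^ p ^ k = 1) (a : N →* N)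
    (ha : ∀ n, σ * act n = act (a n) * σ) (v : N) (x : X) (hv : σ x = act v x) :
    (σ ^ p) x = act (v ^ p) x := by
  obtain ⟨u, hu1, hu2⟩ := hu
  let α : AddMonoid.End (Additive N) := MonoidHom.toAdditive a
  have hα : ∀ n x, σ (act n x) = act (α (.ofMul n)).toMul (σ x) := fun n x =>
    congrArg (fun τ : Equiv.Perm X => τ x) (ha n)
  -- Freeness of the action at `x` transfers the order of `σ` to `α`.
  have hpk : α ^ p ^ k = 1 := by
    ext n
    have := perm_pow_act act σ α hα (p ^ k) n.toMul x
    rw [hσ] at this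
    exact (hinj x this).symm
  have hpnil : IsNilpotent (p : AddMonoid.End (Additive N)) := by
    refine ⟨2, ?_⟩
    ext m
    rw [pow_two, AddMonoid.End.coe_mul, Function.comp_apply, AddMonoid.End.natCast_apply,
      AddMonoid.End.natCast_apply]
    obtain ⟨c, hc⟩ := hu2 m.toMul
    change (m.toMul ^ p) ^ p = 1
    rw [hc, pow_right_comm, hu1, one_pow]
  have hδ := isNilpotent_sub_one_of_pow_eq_one hp α hpk hpnil
  rw [perm_pow_apply act σ α hα v x hv, geom_sum_eq_of_cube_zero hp hp3 α
    (pow_eq_zero_of_isNilpotent_of_card hp 3 (α - 1) hδ hN)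
    (natCast_mul_eq_zero_of_isNilpotent hp (.ofMul u) hu1 hu2 (α - 1) hδ)]
  rfl

end Affine

/-! ### From Hopf Galois structures to regular actions -/

section RegularAction

variable {K L E : Type*} [Field K] [Field L] [Algebra K L] [Field E] [Algebra K E]

/-- The action of `Gal(E/K)` on the set of `K`-embeddings of `L` into `E`. -/
def galPerm : Gal(E/K) →* Equiv.Perm (L →ₐ[K] E) where
  toFun g := AlgEquiv.arrowCongr AlgEquiv.refl g
  map_one' := rfl
  map_mul' _ _ := rfl

theorem galPerm_apply (g : Gal(E/K)) (x : L →ₐ[K] E) :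
    galPerm g x = (g : E →ₐ[K] E).comp x := by
  ext l
  rfl

theorem exists_galPerm_eq [Normal K E] (x y : L →ₐ[K] E) : ∃ g : Gal(E/K), galPerm g x = y := by
  let χ : x.fieldRange ≃ₐ[K] y.fieldRange :=
    (AlgEquiv.ofInjectiveField x).symm.trans (AlgEquiv.ofInjectiveField y)
  refine ⟨χ.liftNormal E, ?_⟩
  ext l
  have := χ.liftNormal_commutes E (AlgEquiv.ofInjectiveField x l)
  rw [show χ (AlgEquiv.ofInjectiveField x l) = AlgEquiv.ofInjectiveField y l from
    congrArg (AlgEquiv.ofInjectiveField y) ((AlgEquiv.ofInjectiveField x).symm_apply_apply l)] at this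
  exact this

/-- One half of the Greither–Pareigis correspondence: a Hopf Galois structure of commutative type
`N` yields a regular action of `N` on the embeddings of `L` into its normal closure, normalised by
the Galois group. -/
theorem exists_regular_action [FiniteDimensional K L] (S : HopfGaloisStructure K L)
    [IsNormalClosure K L E] {N : Type*} [CommGroup N] [Finite N] (hS : S.HasType E N)
    (hN : Nat.card N = Nat.card (L →ₐ[K] E)) :
    ∃ act : N →* Equiv.Perm (L →ₐ[K] E), (∀ x, Function.Bijective fun n => act n x) ∧
      ∀ g : Gal(E/K), ∃ a : N →* N, ∀ n, galPerm g * act n = act (a n) * galPerm g := by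
  classical
  obtain ⟨e⟩ := hS
  have : Fintype N := Fintype.ofFinite N
  have : Fintype (L →ₐ[K] E) := Fintype.ofFinite _
  let u : N →* E ⊗[K] S.H :=
    (e.symm : MonoidAlgebra E N →* E ⊗[K] S.H).comp (MonoidAlgebra.of E N)
  let b : Module.Basis N E (E ⊗[K] S.H) :=
    (MonoidAlgebra.basis N E).map (e.symm : MonoidAlgebra E N ≃ₗ[E] E ⊗[K] S.H)
  have hb : ∀ n, b n = u n := fun n => by simp [b, u]
  have hu : Function.Injective u := fun m n h => b.injective (by rw [hb, hb, h])
  have hgl : ∀ n, IsGroupLikeElem E (u n) := fun n =>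
    (MonoidAlgebra.isGroupLikeElem_of n).map e.symm
  let T : (L →ₐ[K] E) → E ⊗[K] S.H →ₗ[E] (L →ₗ[K] E) := fun x => orbitMap S.μ x.toLinearMap
  have hTs : ∀ x, Function.Surjective (T x) := orbitMap_surjective S.μ S.bijective.2
  have : Module.Finite E (E ⊗[K] S.H) := .of_basis b
  -- Independence of characters bounds the dimension of the target below by the number of
  -- embeddings, which is the order of `N`.
  have hTi : ∀ x, Function.Injective (T x) := fun x => by
    have hfin : Module.Finite E (L →ₗ[K] E) := .of_surjective _ (hTs x)
    rw [LinearMap.injective_iff_surjective_of_finrank_eq_finrank]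
    · exact hTs x
    · refine le_antisymm ?_ (LinearMap.finrank_le_finrank_of_surjective (hTs x))
      rw [Module.finrank_eq_nat_card_basis b, hN, Nat.card_eq_fintype_card]
      exact (linearIndependent_toLinearMap K L E).fintype_card_le_finrank
  have hTu : ∀ x n, ∃ y : L →ₐ[K] E, y.toLinearMap = T x (u n) := fun x n =>
    ⟨AlgHom.ofLinearMap (T x (u n))
      (by rw [orbitMap_apply_one S.μ S.act_one, (hgl n).counit_eq_one])
      (fun l m => by
        rw [orbitMap_apply_mul S.μ S.act_mul, (hgl n).comul_eq_tmul_self]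
        simp [T]), rfl⟩
  choose A hA using fun n x => hTu x n
  have hinj : Function.Injective (AlgHom.toLinearMap : (L →ₐ[K] E) → L →ₗ[K] E) :=
    AlgHom.toLinearMap_injective
  have hA1 : A 1 = id := funext fun x => hinj <| by
    rw [hA, map_one]
    exact orbitMap_one S.μ _
  have hAmul : ∀ m n, A (m * n) = A m ∘ A n := fun m n => funext fun x => hinj <| by
    -- Commutativity of `N` turns the right action into a left one.
    rw [Function.comp_apply, hA, hA m (A n x), mul_comm m n, map_mul]
    simp only [T]
    rw [← orbitMap_orbitMap]
    exact congrArg (fun f => orbitMap S.μ f (u m)) (hA n x).symm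
  let act : N →* Equiv.Perm (L →ₐ[K] E) := MonoidHom.toHomPerm
    { toFun := A
      map_one' := hA1
      map_mul' := hAmul }
  have hact : ∀ n x, act n x = A n x := fun _ _ => rfl
  have hbij : ∀ x, Function.Bijective fun n => act n x := fun x => by
    rw [Fintype.bijective_iff_injective_and_card]
    refine ⟨fun m n h => hu (hTi x ?_), by simpa using hN⟩
    rw [← hA, ← hA]
    exact congrArg _ h
  refine ⟨act, hbij, fun g => ?_⟩
  let γ : E ⊗[K] S.H →ₐ[K] E ⊗[K] S.H := Algebra.TensorProduct.map (g : E →ₐ[K] E) (AlgHom.id K S.H)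
  have hγ : ∀ x n, (galPerm g (A n x)).toLinearMap = T (galPerm g x) (γ (u n)) := fun x n => by
    have h1 := comp_orbitMap S.μ (g : E →ₐ[K] E) x.toLinearMap (u n)
    rw [galPerm_apply, galPerm_apply, AlgHom.comp_toLinearMap, hA]
    exact h1
  cases isEmpty_or_nonempty (L →ₐ[K] E) with
  | inl h => exact ⟨1, fun n => Subsingleton.elim _ _⟩
  | inr h =>
    obtain ⟨x₀⟩ := h
    -- Transitivity at the single point `galPerm g x₀`, with injectivity of `T`, shows that `γ`
    -- preserves the image of `u`; the resulting `n'` then serves every `x`.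
    have hex : ∀ n, ∃ n', u n' = γ (u n) := fun n => by
      obtain ⟨n', hn'⟩ := (hbij (galPerm g x₀)).2 (galPerm g (A n x₀))
      refine ⟨n', hTi (galPerm g x₀) ?_⟩
      rw [← hγ, ← hA]
      exact congrArg _ hn'
    choose a ha using hex
    refine ⟨⟨⟨a, hu (by rw [ha, map_one, map_one])⟩, fun m n => hu ?_⟩, fun n => ?_⟩
    · rw [ha, map_mul, map_mul, map_mul, ha, ha]
    · ext1 x
      refine hinj ?_
      change (galPerm g (A n x)).toLinearMap = (A (a n) (galPerm g x)).toLinearMap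
      rw [hγ, hA, ha]

end RegularAction

end HopfGalois

/-! ### The two types exclude each other -/

theorem mainTheorem5 (p : ℕ) (hp : p.Prime) (hp3 : 3 < p)
    (K L : Type*) [Field K] [Field L] [Algebra K L] [Algebra.IsSeparable K L]
    (hdeg : Module.finrank K L = p ^ 3)
    (E : Type*) [Field E] [Algebra K E] [IsNormalClosure K L E]
    (h : ∃ S : HopfGaloisStructure.{w₁} K L,
      S.HasType E (Multiplicative (ZMod (p ^ 2)) × Multiplicative (ZMod p))) :
    ¬ ∃ S : HopfGaloisStructure.{w₂} K L,
      S.HasType E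
        (Multiplicative (ZMod p) × Multiplicative (ZMod p) × Multiplicative (ZMod p)) := by
  rintro ⟨S₂, hS₂⟩
  obtain ⟨S₁, hS₁⟩ := h
  have : Fact p.Prime := ⟨hp⟩
  have : NeZero (p ^ 2) := ⟨pow_ne_zero _ hp.ne_zero⟩
  have : FiniteDimensional K L :=
    Module.finite_of_finrank_pos (by rw [hdeg]; exact pow_pos hp.pos 3)
  have : Normal K E := IsNormalClosure.normal (K := L)
  have hX : Nat.card (L →ₐ[K] E) = p ^ 3 := by
    rw [AlgHom.natCard_of_splits K L E (IsNormalClosure.splits (F := K)), hdeg]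
  have hN₁ : Nat.card (Multiplicative (ZMod (p ^ 2)) × Multiplicative (ZMod p)) = p ^ 3 := by
    simp [pow_succ]
  have hN₂ : Nat.card
      (Multiplicative (ZMod p) × Multiplicative (ZMod p) × Multiplicative (ZMod p)) = p ^ 3 := by
    simp [pow_succ, mul_assoc]
  obtain ⟨act₁, hreg₁, hnorm₁⟩ := HopfGalois.exists_regular_action S₁ hS₁ (hN₁.trans hX.symm)
  obtain ⟨act₂, hreg₂, hnorm₂⟩ := HopfGalois.exists_regular_action S₂ hS₂ (hN₂.trans hX.symm)
  let G : Subgroup (Equiv.Perm (L →ₐ[K] E)) := (HopfGalois.galPerm (K := K) (L := L) (E := E)).range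
  have : MulAction.IsPretransitive G (L →ₐ[K] E) := ⟨fun x y => by
    obtain ⟨g, hg⟩ := HopfGalois.exists_galPerm_eq x y
    exact ⟨⟨_, g, rfl⟩, hg⟩⟩
  let P : Sylow p G := default
  have hP := HopfGalois.isPretransitive_sylow hX P
  obtain ⟨x₀⟩ : Nonempty (L →ₐ[K] E) := (Nat.card_pos_iff.1 (hX ▸ pow_pos hp.pos 3)).1
  let v₁ : Multiplicative (ZMod (p ^ 2)) × Multiplicative (ZMod p) := (.ofAdd 1, 1)
  obtain ⟨σ, hσ⟩ := hP.exists_smul_eq x₀ (act₁ v₁ x₀)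
  obtain ⟨k, hk⟩ := P.isPGroup' σ
  obtain ⟨⟨τ, g, rfl⟩, hτ⟩ := σ
  have hk' : HopfGalois.galPerm g ^ p ^ k = (1 : Equiv.Perm (L →ₐ[K] E)) :=
    congrArg (fun s : P => ((s : G) : Equiv.Perm (L →ₐ[K] E))) hk
  obtain ⟨a₁, ha₁⟩ := hnorm₁ g
  obtain ⟨a₂, ha₂⟩ := hnorm₂ g
  obtain ⟨v₂, hv₂⟩ := (hreg₂ x₀).2 (HopfGalois.galPerm g x₀)
  have hp_smul : ∀ z : ZMod p, p • z = 0 := fun z => by simp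
  -- Every `p`-th power is a power of `v₁ ^ p`, the exponent being the first coordinate.
  have e₁ := HopfGalois.perm_pow_prime_apply act₁ hp hp3 hN₁
    ⟨v₁, by
      ext
      · change p • p • (1 : ZMod (p ^ 2)) = 0
        rw [← mul_smul, ← pow_two, nsmul_eq_mul, mul_one, ZMod.natCast_self]
      · exact hp_smul _, fun m => ⟨(m.1.toAdd).val, by
      ext
      · change p • m.1.toAdd = (m.1.toAdd).val • p • (1 : ZMod (p ^ 2))
        simp [mul_comm]
      · change p • m.2.toAdd = (m.1.toAdd).val • p • (0 : ZMod p)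
        simp⟩⟩ (fun x => (hreg₁ x).1) _ hk' a₁ ha₁ v₁ x₀ hσ
  have hpow₂ : ∀ m : Multiplicative (ZMod p) × Multiplicative (ZMod p) × Multiplicative (ZMod p),
      m ^ p = 1 := fun m =>
    Prod.ext (hp_smul _) (Prod.ext (hp_smul _) (hp_smul _))
  have e₂ := HopfGalois.perm_pow_prime_apply act₂ hp hp3 hN₂
    ⟨1, by simp, fun m => ⟨0, by simp [hpow₂]⟩⟩ (fun x => (hreg₂ x).1) _ hk' a₂ ha₂ v₂ x₀ hv₂.symm
  -- Both values of `σ ^ p x₀` agree, so freeness gives `v₁ ^ p = 1`, that is, `p = 0` modulo `p ^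
  -- 2`.
  rw [e₁, hpow₂, map_one, ← map_one act₁] at e₂
  have hv₁ := congrArg (fun m => m.1.toAdd) ((hreg₁ x₀).1 e₂)
  have : (p : ZMod (p ^ 2)) = 0 := by simpa [v₁] using hv₁
  rw [ZMod.natCast_eq_zero_iff] at this
  exact absurd (Nat.le_of_dvd hp.pos this) (by nlinarith [hp.two_le])
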